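/- Let $G$ be a Polish group and let $W\leqslant G$ be an open subgroup of infinite index such that $G=\mathrm{Comm}_G(W)$, where $$\mathrm{Comm}_G(W)=\{g\in G : [W:W\cap gWg^{-1}]<\infty \text{ and } [gWg^{-1}:gWg^{-1}\cap W]<\infty\}$$ is the commensurator of $W$ in $G$. Then $G$ admits a continuous affine representation on a separable Hilbert space for which every orbit is unbounded; that is, there are a separable real Hilbert space $\mathcal H$ and a homomorphism $\rho$ from $G$ to the group of affine automorphisms of $\mathcal H$ such that the action map $G\times\mathcal H\to\mathcal H$, $(g,\xi)\mapsto\rho(g)\xi$, is jointly continuous and, for every $\xi\in\mathcal H$, the orbit $\{\rho(g)\xi : g\in G\}$ is unbounded in norm. -/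

import Mathlib

/-!
Since `W` is commensurated, it has finite orbits on `X = G ⧸ W`, so `X` carries a strictly positive
`G`-invariant kernel with small row sums. Its Green function seen from the base point is a summable
`W`-invariant weight `a`, and each element of `G` distorts it by a bounded factor only: translating
the endpoint of a path is the same as translating its starting point, which costs one step.

Conjugate the permutation representation of `G` on `ℓ²(X)` by `r = √a`. The result is a strongly
continuous representation by bounded operators for which `⟪r, ·⟫` is an invariant functional, so `G`
acts by affine maps on the hyperplane through `r` parallel to the kernel of that functional. This
hyperplane avoids the origin, and every nonzero vector has an unbounded orbit: transporting a
nonzero coordinate to `x` multiplies it by a constant over `r x`, while `r` tends to zero at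
infinity.
-/

open MulAction TopologicalSpace Filter Topology
open scoped ENNReal InnerProductSpace Pointwise

universe v

section GreenKernel

variable {G X : Type*} [Group G] [MulAction G X] {K : X → X → ℝ≥0∞} {c : ℝ≥0∞}

open scoped Classical in
/-- The `n`-th power of a nonnegative kernel `K`, regarded as an `X × X` matrix: the weight of all
`n`-step paths from one point to another. -/
noncomputable def kernelPow (K : X → X → ℝ≥0∞) : ℕ → X → X → ℝ≥0∞
  | 0, x, y => if x = y then 1 else 0
  | n + 1, x, y => ∑' z, K x z * kernelPow K n z y

/-- The Green kernel `∑ Kⁿ` of a nonnegative kernel `K`: the weight of all paths from one point to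
another. -/
noncomputable def greenKernel (K : X → X → ℝ≥0∞) (x y : X) : ℝ≥0∞ :=
  ∑' n, kernelPow K n x y

theorem kernelPow_smul_smul (hK : ∀ (g : G) x y, K (g • x) (g • y) = K x y) (n : ℕ) (g : G)
    (x y : X) : kernelPow K n (g • x) (g • y) = kernelPow K n x y := by
  induction n generalizing x with
  | zero =>
    simp only [kernelPow]
    congr 1
    exact propext (smul_left_cancel_iff g)
  | succ n ih =>
    simp only [kernelPow]
    rw [← (MulAction.toPerm g).tsum_eq]
    simp only [MulAction.toPerm_apply, hK, ih]

theorem greenKernel_smul_smul (hK : ∀ (g : G) x y, K (g • x) (g • y) = K x y) (g : G) (x y : X) :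
    greenKernel K (g • x) (g • y) = greenKernel K x y :=
  tsum_congr fun n => kernelPow_smul_smul hK n g x y

theorem tsum_kernelPow_le (hK : ∀ x, ∑' y, K x y ≤ c) (n : ℕ) (x : X) :
    ∑' y, kernelPow K n x y ≤ c ^ n := by
  induction n generalizing x with
  | zero => simp [kernelPow]
  | succ n ih =>
    calc ∑' y, ∑' z, K x z * kernelPow K n z y
        = ∑' z, K x z * ∑' y, kernelPow K n z y := by
          rw [ENNReal.tsum_comm]
          simp only [ENNReal.tsum_mul_left]
      _ ≤ ∑' z, K x z * c ^ n := by
          gcongr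
          exact ih _
      _ ≤ c ^ (n + 1) := by
          rw [ENNReal.tsum_mul_right, pow_succ']
          gcongr
          exact hK x

theorem tsum_greenKernel_le (hK : ∀ x, ∑' y, K x y ≤ c) (x : X) :
    ∑' y, greenKernel K x y ≤ (1 - c)⁻¹ := by
  simp only [greenKernel]
  rw [ENNReal.tsum_comm, ← ENNReal.tsum_geometric]
  exact ENNReal.tsum_le_tsum fun n => tsum_kernelPow_le hK n x

theorem one_le_greenKernel_self (K : X → X → ℝ≥0∞) (x : X) : 1 ≤ greenKernel K x x :=
  calc 1 = kernelPow K 0 x x := by simp [kernelPow]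
    _ ≤ greenKernel K x x := ENNReal.le_tsum 0

theorem mul_greenKernel_le (K : X → X → ℝ≥0∞) (x y z : X) :
    K x z * greenKernel K z y ≤ greenKernel K x y :=
  calc K x z * greenKernel K z y = ∑' n, K x z * kernelPow K n z y := ENNReal.tsum_mul_left.symm
    _ ≤ ∑' n, kernelPow K (n + 1) x y := ENNReal.tsum_le_tsum fun _ => ENNReal.le_tsum z
    _ ≤ greenKernel K x y :=
      ENNReal.tsum_comp_le_tsum_of_injective (add_left_injective 1) fun n => kernelPow K n x y

theorem greenKernel_ne_zero (hK : ∀ x y, K x y ≠ 0) (x y : X) : greenKernel K x y ≠ 0 := by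
  have hy : greenKernel K y y ≠ 0 := (zero_lt_one.trans_le (one_le_greenKernel_self K y)).ne'
  exact ne_bot_of_le_ne_bot (mul_ne_zero (hK x y) hy) (mul_greenKernel_le K x y y)

theorem greenKernel_ne_top (hK : ∀ x, ∑' y, K x y ≤ c) (hc : c < 1) (x y : X) :
    greenKernel K x y ≠ ⊤ :=
  ENNReal.ne_top_of_tsum_ne_top
    (ne_top_of_le_ne_top (ENNReal.inv_ne_top.2 (tsub_pos_of_lt hc).ne')
      (tsum_greenKernel_le hK x)) y

end GreenKernel

section Weight

variable {G X : Type*} [Group G] [MulAction G X]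

theorem finite_setOf_mem_orbit_prod [IsPretransitive G X] {o : X}
    (hfin : ∀ x : X, (orbit (stabilizer G o) x).Finite) (x y : X) :
    {z | (o, z) ∈ orbit G (x, y)}.Finite := by
  obtain ⟨h, rfl⟩ := exists_smul_eq G o x
  refine (hfin (h⁻¹ • y)).subset ?_
  rintro z ⟨g, hg⟩
  obtain ⟨hgo, rfl⟩ := Prod.mk.inj hg
  exact ⟨⟨g * h, by rwa [mem_stabilizer_iff, mul_smul]⟩, by
    simp [mul_smul, Subgroup.smul_def]⟩

theorem exists_smul_invariant_kernel [IsPretransitive G X] [Countable X] {o : X}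
    (hfin : ∀ x : X, (orbit (stabilizer G o) x).Finite) {c : ℝ≥0∞} (hc : c ≠ 0) :
    ∃ K : X → X → ℝ≥0∞, (∀ (g : G) x y, K (g • x) (g • y) = K x y) ∧ (∀ x y, K x y ≠ 0) ∧
      ∀ x, ∑' y, K x y ≤ c := by
  obtain ⟨ε, hε, hsum⟩ := ENNReal.exists_pos_sum_of_countable' hc X
  refine ⟨fun x y => sInf (ε '' {z | (o, z) ∈ orbit G (x, y)}), fun g x y => ?_, fun x y => ?_,
    fun x => ?_⟩
  · simp only [← Prod.smul_mk, orbit_smul]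
  · obtain ⟨g, hg⟩ := exists_smul_eq G x o
    have hne : {z | (o, z) ∈ orbit G (x, y)}.Nonempty := ⟨g • y, g, by simp [hg]⟩
    obtain ⟨z, -, hz⟩ := (hne.image ε).csInf_mem ((finite_setOf_mem_orbit_prod hfin x y).image ε)
    exact hz.symm.trans_ne (hε z).ne'
  · obtain ⟨g, hg⟩ := exists_smul_eq G x o
    calc ∑' y, sInf (ε '' {z | (o, z) ∈ orbit G (x, y)})
        ≤ ∑' y, ε (g • y) :=
          ENNReal.tsum_le_tsum fun y => sInf_le ⟨g • y, ⟨g, by simp [hg]⟩, rfl⟩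
      _ = ∑' y, ε y := (MulAction.toPerm g).tsum_eq ε
      _ ≤ c := hsum.le

variable (G) in
/-- A quasi-invariant weight on a `G`-set: a positive function that every element of `G` distorts
by at most a bounded factor. A lower bound for `r (g • x) / r x` follows by applying the condition
to `g⁻¹`. -/
structure IsQuasiInvariantWeight (r : X → ℝ) : Prop where
  pos : ∀ x, 0 < r x
  exists_smul_le : ∀ g : G, ∃ C : ℝ, ∀ x, r (g • x) ≤ C * r x

theorem IsQuasiInvariantWeight.sqrt {a : X → ℝ} (ha : IsQuasiInvariantWeight G a) :
    IsQuasiInvariantWeight G fun x => √(a x) where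
  pos x := Real.sqrt_pos.2 (ha.pos x)
  exists_smul_le g := by
    obtain ⟨C, hC⟩ := ha.exists_smul_le g
    refine ⟨√C, fun x => ?_⟩
    rw [← Real.sqrt_mul' _ (ha.pos x).le]
    exact Real.sqrt_le_sqrt (hC x)

/-- By invariance, translating the endpoint of the Green kernel amounts to translating its base
point, which costs at most the weight of a single step. -/
theorem isQuasiInvariantWeight_greenKernel {K : X → X → ℝ≥0∞} {c : ℝ≥0∞}
    (hinv : ∀ (g : G) x y, K (g • x) (g • y) = K x y) (hpos : ∀ x y, K x y ≠ 0)
    (hsum : ∀ x, ∑' y, K x y ≤ c) (hc : c < 1) (o : X) :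
    IsQuasiInvariantWeight G fun x => (greenKernel K o x).toReal where
  pos x := ENNReal.toReal_pos (greenKernel_ne_zero hpos o x) (greenKernel_ne_top hsum hc o x)
  exists_smul_le g := by
    have hk : 0 < (K o (g⁻¹ • o)).toReal := ENNReal.toReal_pos (hpos _ _)
      (ENNReal.ne_top_of_tsum_ne_top (ne_top_of_le_ne_top hc.ne_top (hsum o)) _)
    refine ⟨(K o (g⁻¹ • o)).toReal⁻¹, fun x => ?_⟩
    have htranslate : greenKernel K o (g • x) = greenKernel K (g⁻¹ • o) x := by
      rw [← greenKernel_smul_smul hinv g (g⁻¹ • o), smul_inv_smul]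
    rw [htranslate, le_inv_mul_iff₀ hk, ← ENNReal.toReal_mul]
    exact ENNReal.toReal_mono (greenKernel_ne_top hsum hc o x) (mul_greenKernel_le K o x (g⁻¹ • o))

theorem exists_summable_isQuasiInvariantWeight [IsPretransitive G X] [Countable X] {o : X}
    (hfin : ∀ x : X, (orbit (stabilizer G o) x).Finite) :
    ∃ a : X → ℝ, IsQuasiInvariantWeight G a ∧ Summable a ∧
      ∀ g ∈ stabilizer G o, ∀ x, a (g • x) = a x := by
  have hc : (2⁻¹ : ℝ≥0∞) < 1 := by simp
  obtain ⟨K, hinv, hpos, hsum⟩ := exists_smul_invariant_kernel hfin (c := 2⁻¹) (by simp)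
  refine ⟨fun x => (greenKernel K o x).toReal,
    isQuasiInvariantWeight_greenKernel hinv hpos hsum hc o,
    ENNReal.summable_toReal (ne_top_of_le_ne_top (by simp) (tsum_greenKernel_le hsum o)),
    fun g hg x => ?_⟩
  have h := greenKernel_smul_smul hinv g o x
  rw [mem_stabilizer_iff.1 hg] at h
  exact congrArg ENNReal.toReal h

end Weight

section Lp

theorem dense_span_range_lpSingle {X 𝕜 : Type*} [DecidableEq X] {E : X → Type*}
    [∀ x, NormedAddCommGroup (E x)] [NormedRing 𝕜] [∀ x, Module 𝕜 (E x)]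
    [∀ x, IsBoundedSMul 𝕜 (E x)] {p : ℝ≥0∞} [Fact (1 ≤ p)] (hp : p ≠ ∞) :
    Dense (Submodule.span 𝕜 (⋃ x, Set.range (lp.single (E := E) p x)) : Set (lp E p)) := fun f =>
  mem_closure_of_tendsto (lp.hasSum_single hp f) <| .of_forall fun _ =>
    Submodule.sum_mem _ fun x _ => Submodule.subset_span (Set.mem_iUnion_of_mem x ⟨f x, rfl⟩)

theorem separableSpace_lp {X : Type*} [Countable X] {E : X → Type*}
    [∀ x, NormedAddCommGroup (E x)] [∀ x, NormedSpace ℝ (E x)] [∀ x, SeparableSpace (E x)]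
    {p : ℝ≥0∞} [Fact (1 ≤ p)] (hp : p ≠ ∞) : SeparableSpace (lp E p) := by
  classical
  have hsep : IsSeparable (⋃ x, Set.range (lp.single (E := E) p x)) :=
    .iUnion fun x => isSeparable_range (lp.isometry_single x).continuous
  rw [← isSeparable_univ_iff, ← (dense_span_range_lpSingle (𝕜 := ℝ) hp).closure_eq]
  exact (hsep.span (R := ℝ)).closure

variable {X Y : Type*} {E : Y → Type*} [∀ y, NormedAddCommGroup (E y)] {p : ℝ≥0∞} {σ : X → Y}

theorem memℓp_comp_injective {f : ∀ y, E y} (hf : Memℓp f p) (hσ : σ.Injective) :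
    Memℓp (fun x => f (σ x)) p := by
  obtain rfl | rfl | hp := p.trichotomy
  · exact memℓp_zero ((memℓp_zero_iff.1 hf).preimage hσ.injOn)
  · exact memℓp_infty (hf.bddAbove.mono (Set.range_comp_subset_range σ fun y => ‖f y‖))
  · exact memℓp_gen ((hf.summable hp).comp_injective hσ)

variable [∀ y, NormedSpace ℝ (E y)]

/-- Composition with an injective map, as an operator of norm at most one between `ℓᵖ` spaces. -/
noncomputable def lpCompInjective (E : Y → Type*) [∀ y, NormedAddCommGroup (E y)]
    [∀ y, NormedSpace ℝ (E y)] (p : ℝ≥0∞) [Fact (1 ≤ p)] (hσ : σ.Injective) :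
    lp E p →L[ℝ] lp (fun x => E (σ x)) p :=
  LinearMap.mkContinuous
    { toFun := fun f => ⟨fun x => f (σ x), memℓp_comp_injective f.2 hσ⟩
      map_add' := fun _ _ => rfl
      map_smul' := fun _ _ => rfl } 1 fun f => by
    rw [one_mul]
    obtain rfl | hp := p.dichotomy
    · exact lp.norm_le_of_forall_le (norm_nonneg f) fun x =>
        lp.norm_apply_le_norm ENNReal.top_ne_zero f (σ x)
    · have hp0 : 0 < p.toReal := one_pos.trans_le hp
      refine lp.norm_le_of_forall_sum_le hp0 (norm_nonneg f) fun s => ?_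
      exact (Finset.sum_map s ⟨σ, hσ⟩ fun y => ‖f y‖ ^ p.toReal).symm.trans_le
        (lp.sum_rpow_le_norm_rpow hp0 f _)

theorem norm_lpCompInjective_le [Fact (1 ≤ p)] (hσ : σ.Injective) :
    ‖lpCompInjective E p hσ‖ ≤ 1 :=
  LinearMap.mkContinuous_norm_le _ zero_le_one _

end Lp

section WeightedRep

variable {G X E : Type*} [Group G] [MulAction G X] [NormedAddCommGroup E] [NormedSpace ℝ E]
  {p : ℝ≥0∞} [Fact (1 ≤ p)] {r : X → ℝ}

theorem IsQuasiInvariantWeight.exists_norm_div_smul_le (hr : IsQuasiInvariantWeight G r) (g : G) :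
    ∃ C, 0 ≤ C ∧ ∀ x, ‖(r (g • x) / r x) • ContinuousLinearMap.id ℝ E‖ ≤ C := by
  obtain ⟨C, hC⟩ := hr.exists_smul_le g
  refine ⟨|C|, abs_nonneg C, fun x =>
    ContinuousLinearMap.opNorm_le_bound _ (abs_nonneg C) fun v => ?_⟩
  have hle : ‖r (g • x) / r x‖ ≤ |C| := by
    rw [Real.norm_of_nonneg (div_nonneg (hr.pos _).le (hr.pos _).le), div_le_iff₀ (hr.pos x)]
    exact (hC x).trans (mul_le_mul_of_nonneg_right (le_abs_self C) (hr.pos x).le)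
  rw [smul_apply, ContinuousLinearMap.id_apply, norm_smul]
  gcongr

variable (E p) in
/-- The permutation representation of `G` on `E`-valued functions on `X`, conjugated by a
quasi-invariant weight `r` and acting on `ℓᵖ`: multiplication by `r` intertwines it with the
translation action on functions. -/
noncomputable def weightedRep (hr : IsQuasiInvariantWeight G r) :
    G →* (lp (fun _ : X => E) p →L[ℝ] lp (fun _ : X => E) p) where
  toFun g := (lp.mapCLM p (fun x => (r (g⁻¹ • x) / r x) • ContinuousLinearMap.id ℝ E)
      (hr.exists_norm_div_smul_le g⁻¹).choose_spec.1
      (hr.exists_norm_div_smul_le g⁻¹).choose_spec.2).comp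
    (lpCompInjective (fun _ => E) p (MulAction.injective g⁻¹))
  map_one' := by
    ext f x
    change (r ((1 : G)⁻¹ • x) / r x) • f ((1 : G)⁻¹ • x) = f x
    rw [inv_one, one_smul, div_self (hr.pos x).ne', one_smul]
  map_mul' g h := by
    ext f x
    change (r ((g * h)⁻¹ • x) / r x) • f ((g * h)⁻¹ • x) =
      (r (g⁻¹ • x) / r x) • (r (h⁻¹ • g⁻¹ • x) / r (g⁻¹ • x)) • f (h⁻¹ • g⁻¹ • x)
    rw [smul_smul, mul_comm, div_mul_div_cancel₀ (hr.pos _).ne', mul_inv_rev, mul_smul]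

theorem weightedRep_apply (hr : IsQuasiInvariantWeight G r) (g : G) (f : lp (fun _ : X => E) p)
    (x : X) : weightedRep E p hr g f x = (r (g⁻¹ • x) / r x) • f (g⁻¹ • x) := rfl

theorem norm_weightedRep_le_one (hr : IsQuasiInvariantWeight G r) {g : G}
    (hg : ∀ x, r (g • x) = r x) : ‖weightedRep E p hr g‖ ≤ 1 := by
  have hg' (x : X) : r (g⁻¹ • x) = r x := by rw [← hg, smul_inv_smul]
  refine ContinuousLinearMap.opNorm_le_bound _ zero_le_one fun f => ?_
  have heq : weightedRep E p hr g f =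
      lpCompInjective (fun _ => E) p (MulAction.injective g⁻¹) f := by
    ext x
    rw [weightedRep_apply, hg', div_self (hr.pos x).ne', one_smul]
    rfl
  rw [heq]
  exact ContinuousLinearMap.le_of_opNorm_le _ (norm_lpCompInjective_le _) f

theorem weightedRep_single [DecidableEq X] (hr : IsQuasiInvariantWeight G r) {g : G} {x : X}
    (hg : g • x = x) (v : E) :
    weightedRep E p hr g (lp.single p x v) = lp.single p x v := by
  have hg' : g⁻¹ • x = x := inv_smul_eq_iff.2 hg.symm
  ext y
  rw [weightedRep_apply]
  obtain rfl | hy := eq_or_ne y x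
  · rw [hg', div_self (hr.pos y).ne', one_smul]
  · have hy' : g⁻¹ • y ≠ x := by rwa [Ne, inv_smul_eq_iff, hg]
    rw [lp.single_apply_ne _ _ _ hy, lp.single_apply_ne _ _ _ hy', smul_zero]

theorem inner_weightedRep (hr : IsQuasiInvariantWeight G r) {w : lp (fun _ : X => ℝ) 2}
    (hw : ∀ x, w x = r x) (g : G) (f : lp (fun _ : X => ℝ) 2) :
    ⟪w, weightedRep ℝ 2 hr g f⟫_ℝ = ⟪w, f⟫_ℝ := by
  rw [lp.inner_eq_tsum, lp.inner_eq_tsum,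
    ← (MulAction.toPerm g⁻¹).tsum_eq fun x => ⟪w x, f x⟫_ℝ]
  refine tsum_congr fun x => ?_
  have hrx := (hr.pos x).ne'
  rw [weightedRep_apply, hw, toPerm_apply, hw, real_inner_smul_right, Real.inner_apply,
    Real.inner_apply]
  field_simp

theorem not_isBounded_range_weightedRep [IsPretransitive G X] [Infinite X]
    (hr : IsQuasiInvariantWeight G r) (hlim : Tendsto r cofinite (𝓝 0))
    {f : lp (fun _ : X => E) p} (hf : f ≠ 0) :
    ¬ Bornology.IsBounded (Set.range fun g => weightedRep E p hr g f) := by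
  intro hbdd
  obtain ⟨B, hB⟩ := hbdd.exists_norm_le
  obtain ⟨x₀, hx₀⟩ : ∃ x, f x ≠ 0 := Function.ne_iff.1 fun h => hf (lp.ext h)
  have hle (x : X) : r x₀ * ‖f x₀‖ ≤ B * r x := by
    obtain ⟨g, rfl⟩ := exists_smul_eq G x₀ x
    have h := (lp.norm_apply_le_norm (zero_lt_one.trans_le Fact.out).ne' _ (g • x₀)).trans
      (hB _ ⟨g, rfl⟩)
    rwa [weightedRep_apply, inv_smul_smul, norm_smul,
      Real.norm_of_nonneg (div_nonneg (hr.pos _).le (hr.pos _).le), div_mul_eq_mul_div,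
      div_le_iff₀ (hr.pos _)] at h
  have hlim' : Tendsto (fun x => B * r x) cofinite (𝓝 0) := by simpa using hlim.const_mul B
  exact (mul_pos (hr.pos x₀) (norm_pos_iff.2 hx₀)).not_ge (ge_of_tendsto' hlim' hle)

end WeightedRep

section AffineAction

variable {G k V U : Type*} [Group G]

section Algebra

variable [Ring k] [AddCommGroup V] [Module k V] [AddCommGroup U] [Module k U]

/-- The affine action on `ker φ` obtained from a linear action `π` preserving `φ` by identifying
`ker φ` with the invariant coset `w + ker φ` through `v ↦ w + v`. -/
def affineActionOnKer (π : G →* (V →ₗ[k] V)) {φ : V →ₗ[k] U} (hφ : ∀ g v, φ (π g v) = φ v) (w : V) :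
    G →* (φ.ker ≃ᵃ[k] φ.ker) :=
  AffineEquiv.equivUnitsAffineMap.symm.toMonoidHom.comp <| MonoidHom.toHomUnits
    { toFun := fun g =>
        { toFun := fun v => ⟨π g (w + v) - w, by simp [hφ]⟩
          linear := (π g).restrict fun v hv => by simpa [hφ] using hv
          map_vadd' := fun v u => Subtype.ext <| by
            simp only [vadd_eq_add, Submodule.coe_add, LinearMap.restrict_apply, map_add]
            abel }
      map_one' := by
        ext v
        simp
      map_mul' := fun g h => by
        ext v
        simp }

theorem coe_affineActionOnKer (π : G →* (V →ₗ[k] V)) {φ : V →ₗ[k] U}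
    (hφ : ∀ g v, φ (π g v) = φ v) (w : V) (g : G) (v : φ.ker) :
    (affineActionOnKer π hφ w g v : V) = π g (w + v) - w := rfl

theorem continuous_affineActionOnKer [TopologicalSpace G] [TopologicalSpace V]
    [IsTopologicalAddGroup V] {π : G →* (V →ₗ[k] V)} {φ : V →ₗ[k] U}
    (hφ : ∀ g v, φ (π g v) = φ v) (w : V) (hπ : Continuous fun p : G × V => π p.1 p.2) :
    Continuous fun p : G × φ.ker => affineActionOnKer π hφ w p.1 p.2 := by
  refine continuous_induced_rng.2 ?_
  simp only [Function.comp_def, coe_affineActionOnKer]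
  have hadd : Continuous fun p : G × φ.ker => (p.1, w + (p.2 : V)) := by fun_prop
  exact (hπ.comp hadd).sub continuous_const

end Algebra

theorem not_isBounded_range_affineActionOnKer [Ring k] [SeminormedAddCommGroup V] [Module k V]
    [AddCommGroup U] [Module k U] {π : G →* (V →ₗ[k] V)} {φ : V →ₗ[k] U}
    (hφ : ∀ g v, φ (π g v) = φ v) {w : V} (hw : φ w ≠ 0)
    (hπ : ∀ v, v ≠ 0 → ¬ Bornology.IsBounded (Set.range fun g => π g v)) (v : φ.ker) :
    ¬ Bornology.IsBounded (Set.range fun g => affineActionOnKer π hφ w g v) := by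
  have hne : w + (v : V) ≠ 0 := fun h => hw <| by
    simpa [LinearMap.mem_ker.1 v.2] using congrArg φ h
  refine fun hbdd => hπ _ hne ?_
  obtain ⟨B, hB⟩ := hbdd.exists_norm_le
  refine isBounded_iff_forall_norm_le.2 ⟨B + ‖w‖, ?_⟩
  rintro _ ⟨g, rfl⟩
  calc ‖π g (w + v)‖ = ‖(affineActionOnKer π hφ w g v : V) + w‖ := by
        rw [coe_affineActionOnKer, sub_add_cancel]
    _ ≤ ‖(affineActionOnKer π hφ w g v : V)‖ + ‖w‖ := norm_add_le _ _
    _ ≤ B + ‖w‖ := by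
        gcongr
        exact hB _ ⟨g, rfl⟩

end AffineAction

section Continuity

variable {G 𝕜 V : Type*} [Group G] [TopologicalSpace G] [NontriviallyNormedField 𝕜]
  [SeminormedAddCommGroup V] [NormedSpace 𝕜 V] {π : G →* (V →L[𝕜] V)} {C : ℝ} {s : Set V}

theorem tendsto_apply_nhds_one_of_dense_span (hC : ∀ᶠ g in 𝓝 1, ‖π g‖ ≤ C)
    (hs : Dense (Submodule.span 𝕜 s : Set V))
    (hcont : ∀ v ∈ s, Tendsto (fun g => π g v) (𝓝 1) (𝓝 v)) (v : V) :
    Tendsto (fun p : G × V => π p.1 p.2) (𝓝 (1, v)) (𝓝 v) := by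
  have hspan : ∀ d ∈ Submodule.span 𝕜 s, Tendsto (fun g => π g d) (𝓝 1) (𝓝 d) := fun d hd => by
    induction hd using Submodule.span_induction with
    | mem d hd => exact hcont d hd
    | zero => simpa using tendsto_const_nhds
    | add d e _ _ hd he => simpa using hd.add he
    | smul c d _ hd => simpa using hd.const_smul c
  refine Metric.tendsto_nhds.2 fun ε hε => ?_
  have : 0 ≤ C := (norm_nonneg _).trans hC.self_of_nhds
  obtain ⟨δ, hδ, hCδ⟩ := exists_pos_mul_lt hε (C * 2 + 2)
  obtain ⟨d, hd, hvd⟩ := hs.exists_dist_lt v hδ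
  rw [nhds_prod_eq]
  filter_upwards [(hC.and (Metric.tendsto_nhds.1 (hspan d hd) δ hδ)).prod_mk
    (Metric.ball_mem_nhds v hδ)] with p ⟨⟨hp, hpd⟩, hpv⟩
  have hpd' : dist p.2 d ≤ 2 * δ := by
    linarith [dist_triangle p.2 v d, Metric.mem_ball.1 hpv]
  calc dist (π p.1 p.2) v ≤ dist (π p.1 p.2) (π p.1 d) + dist (π p.1 d) d + dist d v :=
        dist_triangle4 ..
    _ ≤ C * (2 * δ) + δ + δ := by
        gcongr
        · rw [dist_eq_norm, ← map_sub]
          exact (π p.1).le_of_opNorm_le_of_le hp (by rwa [← dist_eq_norm])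
        · rw [dist_comm]
          exact hvd.le
    _ = (C * 2 + 2) * δ := by ring
    _ < ε := hCδ

theorem continuous_apply_of_dense_span [IsTopologicalGroup G] (hC : ∀ᶠ g in 𝓝 1, ‖π g‖ ≤ C)
    (hs : Dense (Submodule.span 𝕜 s : Set V))
    (hcont : ∀ v ∈ s, Tendsto (fun g => π g v) (𝓝 1) (𝓝 v)) :
    Continuous fun p : G × V => π p.1 p.2 := by
  refine continuous_iff_continuousAt.2 fun ⟨g₀, v⟩ => ?_
  have htranslate : Tendsto (fun p : G × V => (g₀⁻¹ * p.1, p.2)) (𝓝 (g₀, v)) (𝓝 (1, v)) := by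
    have h : Continuous fun p : G × V => (g₀⁻¹ * p.1, p.2) := by fun_prop
    simpa using h.tendsto (g₀, v)
  refine (((π g₀).continuous.tendsto v).comp
    ((tendsto_apply_nhds_one_of_dense_span hC hs hcont v).comp htranslate)).congr fun p => ?_
  simp only [Function.comp_apply, ← mul_apply_eq_comp, ← map_mul, mul_inv_cancel_left]

end Continuity

theorem continuous_weightedRep {G X E : Type*} [Group G] [TopologicalSpace G] [IsTopologicalGroup G]
    [MulAction G X] [NormedAddCommGroup E] [NormedSpace ℝ E] {p : ℝ≥0∞} [Fact (1 ≤ p)] (hp : p ≠ ∞)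
    {r : X → ℝ} (hr : IsQuasiInvariantWeight G r) (hinv : ∀ᶠ g : G in 𝓝 1, ∀ x, r (g • x) = r x)
    (hopen : ∀ x : X, IsOpen (stabilizer G x : Set G)) :
    Continuous fun q : G × lp (fun _ : X => E) p => weightedRep E p hr q.1 q.2 := by
  classical
  refine continuous_apply_of_dense_span (hinv.mono fun g hg => norm_weightedRep_le_one hr hg)
    (dense_span_range_lpSingle hp) fun f hf => ?_
  obtain ⟨x, v, rfl⟩ := Set.mem_iUnion.1 hf
  refine tendsto_const_nhds.congr' ?_
  filter_upwards [(hopen x).mem_nhds (one_mem _)] with g hg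
  exact (weightedRep_single hr hg v).symm

section Stabilizer

variable {G : Type*} [Group G]

theorem isOpen_stabilizer_of_isPretransitive {X : Type*} [MulAction G X] [IsPretransitive G X]
    [TopologicalSpace G] [IsTopologicalGroup G] {o : X} (ho : IsOpen (stabilizer G o : Set G))
    (x : X) : IsOpen (stabilizer G x : Set G) := by
  obtain ⟨g, rfl⟩ := exists_smul_eq G o x
  have hconj : Continuous fun h : G => g⁻¹ * h * g := by fun_prop
  convert ho.preimage hconj using 1
  ext h
  simp [mul_smul, inv_smul_eq_iff]

theorem finite_orbit_iff_relIndex_stabilizer_ne_zero {X : Type*} [MulAction G X] (H : Subgroup G)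
    (x : X) : (orbit H x).Finite ↔ (stabilizer G x).relIndex H ≠ 0 := by
  have hstab : (stabilizer G x).subgroupOf H = stabilizer H x := rfl
  rw [Subgroup.relIndex, hstab, index_stabilizer]
  exact ⟨fun h => Set.ncard_ne_zero_of_mem (mem_orbit_self x) h, Set.finite_of_ncard_ne_zero⟩

theorem countable_quotient_of_isOpen [TopologicalSpace G] [ContinuousMul G] [SeparableSpace G]
    {W : Subgroup G} (hW : IsOpen (W : Set G)) : Countable (G ⧸ W) :=
  have : DiscreteTopology (G ⧸ W) := QuotientGroup.discreteTopology hW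
  separableSpace_iff_countable.1 <|
    (QuotientGroup.mk_surjective (s := W)).denseRange.separableSpace QuotientGroup.continuous_mk

theorem stabilizer_quotientGroup_mk (W : Subgroup G) (g : G) :
    stabilizer G (g : G ⧸ W) = ConjAct.toConjAct g • W := by
  ext h
  rw [mem_stabilizer_iff, eq_comm, Subgroup.mem_pointwise_smul_iff_inv_smul_mem, ← map_inv,
    ConjAct.toConjAct_smul, inv_inv, mul_assoc]
  exact QuotientGroup.eq

theorem stabilizer_equivShrink {X : Type*} [Small X] [MulAction G X] (x : X) :
    stabilizer G (equivShrink X x) = stabilizer G x := by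
  ext g
  rw [mem_stabilizer_iff, mem_stabilizer_iff, ← equivShrink_smul, EmbeddingLike.apply_eq_iff_eq]

end Stabilizer

theorem exists_unbounded_affineAction_of_finite_orbit {G : Type*} {X : Type v} [Group G]
    [TopologicalSpace G] [IsTopologicalGroup G] [MulAction G X] [IsPretransitive G X]
    [Countable X] [Infinite X] {o : X} (hopen : IsOpen (stabilizer G o : Set G))
    (hfin : ∀ x : X, (orbit (stabilizer G o) x).Finite) :
    ∃ (H : Type v) (_ : NormedAddCommGroup H) (_ : InnerProductSpace ℝ H)
      (_ : CompleteSpace H) (_ : SeparableSpace H) (ρ : G →* (H ≃ᵃ[ℝ] H)),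
      Continuous (fun p : G × H => ρ p.1 p.2) ∧
      ∀ x : H, ¬ Bornology.IsBounded (Set.range fun g : G => ρ g x) := by
  obtain ⟨a, ha, hsum, hinv⟩ := exists_summable_isQuasiInvariantWeight hfin
  have hr := ha.sqrt
  have hw : Memℓp (fun x => √(a x)) 2 :=
    memℓp_gen (by simpa [Real.sq_sqrt (ha.pos _).le] using hsum)
  let w : lp (fun _ : X => ℝ) 2 := ⟨_, hw⟩
  have hw0 : ⟪w, w⟫_ℝ ≠ 0 := inner_self_ne_zero.2 fun h =>
    (hr.pos o).ne' (congrFun (congrArg Subtype.val h) o)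
  have hinner := inner_weightedRep hr (w := w) fun _ => rfl
  have hcont : Continuous fun q : G × lp (fun _ : X => ℝ) 2 => weightedRep ℝ 2 hr q.1 q.2 := by
    refine continuous_weightedRep ENNReal.ofNat_ne_top hr ?_
      (isOpen_stabilizer_of_isPretransitive hopen)
    filter_upwards [hopen.mem_nhds (one_mem _)] with g hg x
    rw [hinv g hg]
  have hlim : Tendsto (fun x => √(a x)) cofinite (𝓝 0) := by
    simpa using hsum.tendsto_cofinite_zero.sqrt
  have : SeparableSpace (lp (fun _ : X => ℝ) 2) := separableSpace_lp ENNReal.ofNat_ne_top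
  let π := (ContinuousLinearMap.toLinearMapRingHom.toMonoidHom).comp (weightedRep ℝ 2 hr)
  exact ⟨(innerSL ℝ w).ker, inferInstance, inferInstance, inferInstance,
    (IsSeparable.of_separableSpace _).separableSpace, affineActionOnKer π hinner w,
    continuous_affineActionOnKer hinner w hcont,
    not_isBounded_range_affineActionOnKer hinner hw0 fun v hv =>
      not_isBounded_range_weightedRep hr hlim hv⟩

theorem mainTheorem7_general {G : Type*} [Group G] [TopologicalSpace G] [IsTopologicalGroup G]
    (W : Subgroup G) [Countable (G ⧸ W)] (hW_open : IsOpen (W : Set G))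
    (hW_index : ¬ W.FiniteIndex)
    (hW_comm : Subgroup.Commensurable.commensurator W = ⊤) :
    ∃ (H : Type) (_ : NormedAddCommGroup H) (_ : InnerProductSpace ℝ H)
      (_ : CompleteSpace H) (_ : SeparableSpace H) (ρ : G →* (H ≃ᵃ[ℝ] H)),
      Continuous (fun p : G × H => ρ p.1 p.2) ∧
      ∀ x : H, ¬ Bornology.IsBounded (Set.range fun g : G => ρ g x) := by
  let e := equivShrink.{0} (G ⧸ W)
  have : Countable (Shrink.{0} (G ⧸ W)) := e.symm.injective.countable
  have : Infinite (Shrink.{0} (G ⧸ W)) := e.infinite_iff.1 <|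
    not_finite_iff_infinite.1 fun _ => hW_index Subgroup.finiteIndex_of_finite_quotient
  have : IsPretransitive G (Shrink.{0} (G ⧸ W)) :=
    .of_surjective_map (f := ⟨e, equivShrink_smul.{0}⟩) e.surjective inferInstance
  have hstab (g : G) : stabilizer G (e g) = ConjAct.toConjAct g • W :=
    (stabilizer_equivShrink _).trans (stabilizer_quotientGroup_mk W g)
  have hstab_one : stabilizer G (e (1 : G)) = W := by rw [hstab, map_one, one_smul]
  refine exists_unbounded_affineAction_of_finite_orbit (o := e (1 : G)) (by rwa [hstab_one])
    fun x => ?_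
  obtain ⟨g, rfl⟩ := (e.surjective.comp QuotientGroup.mk_surjective) x
  rw [finite_orbit_iff_relIndex_stabilizer_ne_zero, hstab_one, Function.comp_apply, hstab]
  have hg : g ∈ Subgroup.Commensurable.commensurator W := hW_comm ▸ Subgroup.mem_top g
  exact hg.1

theorem mainTheorem7 {G : Type*} [Group G] [TopologicalSpace G] [IsTopologicalGroup G]
    [PolishSpace G] (W : Subgroup G) (hW_open : IsOpen (W : Set G))
    (hW_index : ¬ W.FiniteIndex)
    (hW_comm : Subgroup.Commensurable.commensurator W = ⊤) :
    ∃ (H : Type) (_ : NormedAddCommGroup H) (_ : InnerProductSpace ℝ H)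
      (_ : CompleteSpace H) (_ : TopologicalSpace.SeparableSpace H)
      (ρ : G →* (H ≃ᵃ[ℝ] H)),
      Continuous (fun p : G × H => ρ p.1 p.2) ∧
      ∀ x : H, ¬ Bornology.IsBounded (Set.range fun g : G => ρ g x) := by
  have := countable_quotient_of_isOpen hW_open
  exact mainTheorem7_general W hW_open hW_index hW_comm
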